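/- Assume Martin's Axiom: for every nonempty partially ordered set $P$ satisfying the countable chain condition and every family of fewer than $\mathfrak c = 2^{\aleph_0}$ dense subsets of $P$, there is a filter on $P$ meeting every member of the family. All spaces are Hausdorff; in particular, regular spaces are $T_3$. Let $X$ be a first countable regular space of cardinality $< \mathfrak c$. Then Nagata's conjecture holds for $X$: if $X$ is an $M$-space, then $X$ is homeomorphic to a closed subspace of the product of a countably compact space and a metric space. Moreover, $X$ (whether or not it is an $M$-space) has a maximal first-countable extension, i.e. there is a first countable space $Y$ containing $X$ as a dense subspace such that $Y$ is closed in every first countable space $Z$ that contains $Y$ as a subspace. Here $X$ is an $M$-space if there is a sequence $(\mathcal U_n)_{n\in\omega}$ of open covers of $X$ such that (i) $\mathcal U_{n+1}$ star-refines $\mathcal U_n$ for all $n$, that is, for each $V\in\mathcal U_{n+1}$ the union of all members of $\mathcal U_{n+1}$ that meet $V$ is contained in some member of $\mathcal U_n$; and (ii) whenever $x \in X$ and $x_n \in \mathrm{St}(x,\mathcal U_n)=\bigcup\{U\in\mathcal U_n : x\in U\}$ for all $n$, the sequence $(x_n)$ has a cluster point in $X$, that is, a point each of whose neighbourhoods contains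 $x_n$ for infinitely many $n$. -/

import Mathlib

open Set Filter Topology

universe u

/-- Two conditions of a forcing poset are compatible if they have a common lower bound. -/
def ForcingCompatible {P : Type u} [PartialOrder P] (p q : P) : Prop :=
  ∃ r : P, r ≤ p ∧ r ≤ q

/-- The countable chain condition: every set of pairwise incompatible conditions is countable. -/
def IsCCC (P : Type u) [PartialOrder P] : Prop :=
  ∀ A : Set P, A.Pairwise (fun p q => ¬ ForcingCompatible p q) → A.Countable

/-- `D` is dense in the poset `P`: every condition has an extension (a smaller condition) in `D`. -/
def IsForcingDense {P : Type u} [PartialOrder P] (D : Set P) : Prop :=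
  ∀ p : P, ∃ d ∈ D, d ≤ p

/-- Martin's Axiom: for every nonempty c.c.c. poset `P` and every family of fewer than `𝔠` dense
subsets of `P` there is a filter on `P` which meets every member of the family. -/
def MartinsAxiom : Prop :=
  ∀ (P : Type) [PartialOrder P] [Nonempty P], IsCCC P →
    ∀ 𝒟 : Set (Set P), Cardinal.mk 𝒟 < Cardinal.continuum → (∀ D ∈ 𝒟, IsForcingDense D) →
      ∃ G : Order.PFilter P, ∀ D ∈ 𝒟, ∃ p ∈ D, p ∈ G

/-- The star `St(A, 𝒰)`: the union of all members of `𝒰` that meet `A`. -/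
def coverStar {X : Type u} (A : Set X) (𝒰 : Set (Set X)) : Set X :=
  ⋃₀ {U ∈ 𝒰 | (U ∩ A).Nonempty}

/-- `𝒰` is an open cover of `X`. -/
def IsOpenSetCover {X : Type u} [TopologicalSpace X] (𝒰 : Set (Set X)) : Prop :=
  (∀ U ∈ 𝒰, IsOpen U) ∧ ⋃₀ 𝒰 = univ

/-- `𝒱` star-refines `𝒰`: the star in `𝒱` of each member of `𝒱` is contained in a member of `𝒰`. -/
def StarRefines {X : Type u} (𝒱 𝒰 : Set (Set X)) : Prop :=
  ∀ V ∈ 𝒱, ∃ U ∈ 𝒰, coverStar V 𝒱 ⊆ U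

/-- `X` is an M-space: there is a sequence of open covers `𝒰 n`, each star-refining the preceding
one, such that every sequence with `s n ∈ St(x, 𝒰 n)` for all `n` has a cluster point. -/
def IsMSpace (X : Type u) [TopologicalSpace X] : Prop :=
  ∃ 𝒰 : ℕ → Set (Set X),
    (∀ n, IsOpenSetCover (𝒰 n)) ∧
    (∀ n, StarRefines (𝒰 (n + 1)) (𝒰 n)) ∧
    ∀ (x : X) (s : ℕ → X), (∀ n, s n ∈ coverStar {x} (𝒰 n)) → ∃ p : X, MapClusterPt p atTop s

/-- `X` is homeomorphic to a closed subspace of the product of a countably compact (Hausdorff)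
space and a metric space. -/
def EmbedsClosedInCountablyCompactProdMetric (X : Type u) [TopologicalSpace X] : Prop :=
  ∃ (C : Type u) (_ : TopologicalSpace C) (M : Type u) (_ : MetricSpace M),
    T2Space C ∧ CountablyCompactSpace C ∧
      ∃ F : Set (C × M), IsClosed F ∧ Nonempty (X ≃ₜ F)

/-- The embedding `i : X → Y` makes `Y` a maximal first-countable extension of `X`, in the class of
Hausdorff spaces: `Y` is first countable, `i` identifies `X` with a dense subspace of `Y`, and `Y`
is closed in every first countable space containing it as a subspace. (Testing this on spaces `Z`
in the universe of `Y` is enough: if `Y` is not closed in `Z`, then it is not closed in the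
subspace of `Z` obtained by adding to `Y` a single point of its closure.) -/
structure IsMaximalFirstCountableExtension {X Y : Type u} [TopologicalSpace X]
    [TopologicalSpace Y] (i : X → Y) : Prop where
  t2 : T2Space Y
  firstCountable : FirstCountableTopology Y
  isEmbedding : IsEmbedding i
  denseRange : DenseRange i
  isClosed_range : ∀ (Z : Type u) [TopologicalSpace Z] [T2Space Z] [FirstCountableTopology Z]
    (j : Y → Z), IsEmbedding j → IsClosed (range j)

/-! Both conclusions follow once `X` is densely embedded in a countably compact, first countable
Hausdorff space `Y`. Such a `Y` is sequentially compact, so its image in any first countable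
Hausdorff space is closed, which is maximality. If `X` is an M-space, its covers give a continuous
map `f` onto a metric space such that a sequence whose image converges has a cluster point. Pairing
`f` with the embedding into `Y` gives a closed embedding: a limit of points of the graph is the
image of such a cluster point.

To obtain `Y`, points are added to `X` in a recursion of length `𝔠`. Each stage is a regular first
countable space with fewer than `𝔠` points, and the new point is made a cluster point of a listed
sequence that has none. As `𝔠` has uncountable cofinality and `𝔠 ^ ℵ₀ = 𝔠`, every sequence of the
final space can be listed after all its terms have appeared. The closure of `X` in the result is
`Y`.

Martin's Axiom enters when one point is added for a sequence `d`. An ultrafilter on `ℕ` decides, for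
each basic set `B y n`, whether `d j ∈ B y n` for most `j`; accordingly small balls around `d j` lie
inside `B y n` or miss `B y (n + 1)`. A pseudo-intersection of these fewer than `𝔠` requirements
selects balls around infinitely many terms, and the tails of their union are the neighbourhood
traces of the new point (`MartinsAxiom.exists_trace`). -/

/-! ### Pseudo-intersections from Martin's Axiom -/

/-- Conditions of the forcing which adds a pseudo-intersection of the family `𝒜`: a finite
approximation together with finitely many members of `𝒜` to be respected from now on. -/
structure PseudoIntersectionPoset {S : Type} (𝒜 : Set (Set S)) where
  /-- the finite approximation -/
  stem : Finset S
  /-- the promises -/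
  side : Finset 𝒜

namespace PseudoIntersectionPoset

variable {S : Type} {𝒜 : Set (Set S)}

instance : PartialOrder (PseudoIntersectionPoset 𝒜) where
  le q p := p.stem ⊆ q.stem ∧ p.side ⊆ q.side ∧
    ∀ s ∈ q.stem, s ∉ p.stem → ∀ A ∈ p.side, s ∈ (A : Set S)
  le_refl p := ⟨Finset.Subset.refl _, Finset.Subset.refl _, fun s h h' => absurd h h'⟩
  le_trans r q p hrq hqp := by
    refine ⟨hqp.1.trans hrq.1, hqp.2.1.trans hrq.2.1, fun s hs hsp A hA => ?_⟩
    by_cases h : s ∈ q.stem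
    · exact hqp.2.2 s h hsp A hA
    · exact hrq.2.2 s hs h A (hqp.2.1 hA)
  le_antisymm p q hpq hqp := by
    cases p; cases q
    simp only [mk.injEq]
    exact ⟨hqp.1.antisymm hpq.1, hqp.2.1.antisymm hpq.2.1⟩

theorem compatible_of_stem_eq {p q : PseudoIntersectionPoset 𝒜} (h : p.stem = q.stem) :
    ForcingCompatible p q := by
  classical
  refine ⟨⟨p.stem, p.side ∪ q.side⟩, ?_, ?_⟩
  · exact ⟨Finset.Subset.refl _, Finset.subset_union_left, fun s hs hs' => absurd hs hs'⟩
  · exact ⟨h.symm.subset, Finset.subset_union_right, fun s hs hs' => absurd (h ▸ hs) hs'⟩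

/-- Conditions with the same stem are compatible, by uniting their promises, and there are only
countably many stems. -/
theorem isCCC [Countable S] : IsCCC (PseudoIntersectionPoset 𝒜) := by
  intro A hA
  have hinj : InjOn stem A := fun p hp q hq h => by
    by_contra hne
    exact hA hp hq hne (compatible_of_stem_eq h)
  exact (mapsTo_univ stem A).countable_of_injOn hinj countable_univ

theorem isForcingDense_side (A : 𝒜) : IsForcingDense {p : PseudoIntersectionPoset 𝒜 | A ∈ p.side} := by
  classical
  intro p
  exact ⟨⟨p.stem, insert A p.side⟩, Finset.mem_insert_self _ _, Finset.Subset.refl _,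
    Finset.subset_insert _ _, fun s hs hs' => absurd hs hs'⟩

theorem isForcingDense_stem (h𝒜 : ∀ F : Finset 𝒜, {s : S | ∀ A ∈ F, s ∈ (A : Set S)}.Infinite)
    (F : Finset S) : IsForcingDense {p : PseudoIntersectionPoset 𝒜 | ∃ s ∈ p.stem, s ∉ F} := by
  classical
  intro p
  obtain ⟨s, hs, hsF⟩ := (h𝒜 p.side).exists_notMem_finset F
  refine ⟨⟨insert s p.stem, p.side⟩, ⟨s, Finset.mem_insert_self _ _, hsF⟩,
    Finset.subset_insert _ _, Finset.Subset.refl _, fun t ht ht' A hA => ?_⟩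
  rcases Finset.mem_insert.1 ht with rfl | h
  · exact hs A hA
  · exact absurd h ht'

end PseudoIntersectionPoset

/-- Martin's Axiom implies that a family of fewer than `𝔠` subsets of a countable set, all finite
intersections of which are infinite, has an infinite pseudo-intersection. -/
theorem MartinsAxiom.exists_pseudoIntersection (hMA : MartinsAxiom) {S : Type} [Countable S]
    {𝒜 : Set (Set S)} (hc : Cardinal.mk 𝒜 < Cardinal.continuum)
    (h𝒜 : ∀ F : Finset 𝒜, {s : S | ∀ A ∈ F, s ∈ (A : Set S)}.Infinite) :
    ∃ P : Set S, P.Infinite ∧ ∀ A ∈ 𝒜, (P \ A).Finite := by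
  classical
  let D : 𝒜 ⊕ Finset S → Set (PseudoIntersectionPoset 𝒜) :=
    Sum.elim (fun A => {p | A ∈ p.side}) (fun F => {p | ∃ s ∈ p.stem, s ∉ F})
  have hD : Cardinal.mk (range D) < Cardinal.continuum := by
    refine Cardinal.mk_range_le.trans_lt ?_
    rw [Cardinal.mk_sum, Cardinal.lift_id, Cardinal.lift_id]
    exact Cardinal.add_lt_of_lt Cardinal.aleph0_le_continuum hc
      (Cardinal.mk_le_aleph0.trans_lt Cardinal.aleph0_lt_continuum)
  have : Nonempty (PseudoIntersectionPoset 𝒜) := ⟨⟨∅, ∅⟩⟩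
  obtain ⟨G, hG⟩ := hMA (PseudoIntersectionPoset 𝒜) PseudoIntersectionPoset.isCCC (range D) hD (by
    rintro _ ⟨A | F, rfl⟩
    · exact PseudoIntersectionPoset.isForcingDense_side A
    · exact PseudoIntersectionPoset.isForcingDense_stem h𝒜 F)
  refine ⟨{s | ∃ p ∈ G, s ∈ p.stem}, fun hfin => ?_, fun A hA => ?_⟩
  · obtain ⟨p, ⟨s, hs, hsF⟩, hp⟩ := hG _ ⟨Sum.inr hfin.toFinset, rfl⟩
    exact hsF (hfin.mem_toFinset.2 ⟨p, hp, hs⟩)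
  · obtain ⟨p, hpA, hp⟩ := hG _ ⟨Sum.inl ⟨A, hA⟩, rfl⟩
    refine p.stem.finite_toSet.subset ?_
    rintro s ⟨⟨q, hq, hs⟩, hsA⟩
    by_contra hsp
    obtain ⟨r, hr, hrp, hrq⟩ := G.directed p hp q hq
    -- In the common extension `r`, the element `s` was added after `p` had promised `A`.
    exact hsA (hrp.2.2 s (hrq.1 hs) hsp ⟨A, hA⟩ hpA)

/-! ### Regular neighbourhood bases and traces of a new point -/

/-- The sets `B y n`, traced on `S`, form decreasing open neighbourhood bases of a regular `T₁`
topology on `S`, in which the closure of `B y (n + 1)` is contained in `B y n`. -/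
structure IsRegularBaseOn {Y : Type u} (S : Set Y) (B : Y → ℕ → Set Y) : Prop where
  mem : ∀ y ∈ S, ∀ n, y ∈ B y n
  anti : ∀ y ∈ S, ∀ n, B y (n + 1) ∩ S ⊆ B y n
  isOpen : ∀ y ∈ S, ∀ z ∈ S, ∀ n, z ∈ B y n → ∃ m, B z m ∩ S ⊆ B y n
  t1 : ∀ y ∈ S, ∀ z ∈ S, z ≠ y → ∃ n, z ∉ B y n
  regular : ∀ y ∈ S, ∀ z ∈ S, ∀ n, z ∉ B y n → ∃ m, Disjoint (B z m ∩ S) (B y (n + 1))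

/-- The sets `W k` can serve as traces on `S` of the basic neighbourhoods of a new point. -/
structure IsTraceOn {Y : Type u} (S : Set Y) (B : Y → ℕ → Set Y) (W : ℕ → Set Y) : Prop where
  isOpen : ∀ z ∈ S, ∀ k, z ∈ W k → ∃ m, B z m ∩ S ⊆ W k
  sep : ∀ y ∈ S, ∀ n, (∃ k, W k ⊆ B y n) ∨ ∃ k, Disjoint (W k) (B y (n + 1))
  avoid : ∀ y ∈ S, ∃ n k, Disjoint (W k) (B y n)
  regular : ∀ k, ∀ y ∈ S, y ∉ W k → ∃ m, Disjoint (B y m ∩ S) (W (k + 1))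

section congr

variable {Y : Type u} {S : Set Y} {B B' : Y → ℕ → Set Y} {W : ℕ → Set Y}

theorem IsRegularBaseOn.congr (hB : IsRegularBaseOn S B)
    (h : ∀ y ∈ S, ∀ n, ∀ z ∈ S, z ∈ B y n ↔ z ∈ B' y n) : IsRegularBaseOn S B' where
  mem y hy n := (h y hy n y hy).1 (hB.mem y hy n)
  anti y hy n z hz := (h y hy n z hz.2).1
    (hB.anti y hy n ⟨(h y hy (n + 1) z hz.2).2 hz.1, hz.2⟩)
  isOpen y hy z hz n hzn := by
    obtain ⟨m, hm⟩ := hB.isOpen y hy z hz n ((h y hy n z hz).2 hzn)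
    exact ⟨m, fun w hw => (h y hy n w hw.2).1 (hm ⟨(h z hz m w hw.2).2 hw.1, hw.2⟩)⟩
  t1 y hy z hz hne := by
    obtain ⟨n, hn⟩ := hB.t1 y hy z hz hne
    exact ⟨n, fun h' => hn ((h y hy n z hz).2 h')⟩
  regular y hy z hz n hzn := by
    obtain ⟨m, hm⟩ := hB.regular y hy z hz n (fun h' => hzn ((h y hy n z hz).1 h'))
    refine ⟨m, Set.disjoint_left.2 fun w hw hw' => ?_⟩
    exact Set.disjoint_left.1 hm ⟨(h z hz m w hw.2).2 hw.1, hw.2⟩ ((h y hy _ w hw.2).2 hw')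

theorem IsTraceOn.congr (hW : IsTraceOn S B W) (hS : ∀ k, W k ⊆ S)
    (h : ∀ y ∈ S, ∀ n, ∀ z ∈ S, z ∈ B y n ↔ z ∈ B' y n) : IsTraceOn S B' W where
  isOpen z hz k hzk := by
    obtain ⟨m, hm⟩ := hW.isOpen z hz k hzk
    exact ⟨m, fun w hw => hm ⟨(h z hz m w hw.2).2 hw.1, hw.2⟩⟩
  sep y hy n := by
    refine (hW.sep y hy n).imp ?_ ?_
    · rintro ⟨k, hk⟩
      exact ⟨k, fun w hw => (h y hy n w (hS k hw)).1 (hk hw)⟩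
    · rintro ⟨k, hk⟩
      exact ⟨k, Set.disjoint_left.2 fun w hw hw' =>
        Set.disjoint_left.1 hk hw ((h y hy _ w (hS k hw)).2 hw')⟩
  avoid y hy := by
    obtain ⟨n, k, hk⟩ := hW.avoid y hy
    exact ⟨n, k, Set.disjoint_left.2 fun w hw hw' =>
      Set.disjoint_left.1 hk hw ((h y hy _ w (hS k hw)).2 hw')⟩
  regular k y hy hyk := by
    obtain ⟨m, hm⟩ := hW.regular k y hy hyk
    exact ⟨m, Set.disjoint_left.2 fun w hw hw' =>
      Set.disjoint_left.1 hm ⟨(h y hy m w hw.2).2 hw.1, hw.2⟩ hw'⟩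

end congr

theorem IsRegularBaseOn.anti_le {Y : Type u} {S : Set Y} {B : Y → ℕ → Set Y}
    (hB : IsRegularBaseOn S B) {y : Y} (hy : y ∈ S) {m n : ℕ} (hmn : m ≤ n) :
    B y n ∩ S ⊆ B y m := by
  induction n, hmn using Nat.le_induction with
  | base => exact inter_subset_left
  | succ n _ ih => exact fun z hz => ih ⟨hB.anti y hy n hz, hz.2⟩

/-! ### Adding one cluster point -/

/-- Under Martin's Axiom, a family of fewer than `𝔠` sets in `(hyperfilter ℕ).curry atTop` has a
pseudo-intersection in which every column is finite and which meets infinitely many columns. -/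
theorem MartinsAxiom.exists_pseudoIntersection_curry (hMA : MartinsAxiom) {ι : Type u}
    (hι : Cardinal.mk ι < Cardinal.continuum) (A : ι → Set (ℕ × ℕ))
    (hA : ∀ i, A i ∈ ((hyperfilter ℕ : Filter ℕ).curry atTop)) :
    ∃ P : Set (ℕ × ℕ), (∀ m, (P ∩ {q | q.1 < m}).Finite) ∧ (∀ m, ∃ q ∈ P, m ≤ q.1) ∧
      ∀ i, ∃ m, ∀ q ∈ P, m ≤ q.1 → q ∈ A i := by
  have hle : ∀ m : ℕ, {q : ℕ × ℕ | m ≤ q.1} ∈ ((hyperfilter ℕ : Filter ℕ).curry atTop) := by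
    intro m
    rw [mem_curry_iff]
    have : ∀ᶠ j in (hyperfilter ℕ : Filter ℕ), m ≤ j :=
      hyperfilter_le_cofinite (by rw [Nat.cofinite_eq_atTop]; exact eventually_ge_atTop m)
    filter_upwards [this] with j hj
    exact Eventually.of_forall fun k => hj
  let C : ι ⊕ ULift.{u} ℕ → Set (ℕ × ℕ) := Sum.elim A (fun m => {q | m.down ≤ q.1})
  have hC : ∀ i, C i ∈ ((hyperfilter ℕ : Filter ℕ).curry atTop) := by
    rintro (i | m)
    exacts [hA i, hle m.down]
  have hcard : Cardinal.mk (range C) < Cardinal.continuum := by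
    have h1 := Cardinal.mk_range_le_lift (f := C)
    have h2 : Cardinal.mk (ι ⊕ ULift.{u} ℕ) < Cardinal.continuum := by
      rw [Cardinal.mk_sum, Cardinal.lift_id, Cardinal.lift_id]
      exact Cardinal.add_lt_of_lt Cardinal.aleph0_le_continuum hι
        (Cardinal.mk_le_aleph0.trans_lt Cardinal.aleph0_lt_continuum)
    rw [← Cardinal.lift_lt.{0, u}, Cardinal.lift_continuum]
    refine h1.trans_lt ?_
    rwa [Cardinal.lift_lt_continuum]
  obtain ⟨P, hP, hPA⟩ := hMA.exists_pseudoIntersection hcard (by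
    intro F hfin
    have hF : {s : ℕ × ℕ | ∀ A ∈ F, s ∈ (A : Set (ℕ × ℕ))} ∈
        ((hyperfilter ℕ : Filter ℕ).curry atTop) := by
      have : (⋂ A ∈ F, (A : Set (ℕ × ℕ))) ∈ ((hyperfilter ℕ : Filter ℕ).curry atTop) := by
        rw [Filter.biInter_finset_mem]
        rintro ⟨_, i, rfl⟩ -
        exact hC i
      convert this using 1
      ext; simp
    -- A finite intersection would have bounded first coordinates, but the filter is proper and
    -- contains all sets of late columns.
    obtain ⟨m, hm⟩ := (hfin.image Prod.fst).bddAbove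
    have : ((hyperfilter ℕ : Filter ℕ).curry (atTop : Filter ℕ)).NeBot := by
      rw [neBot_iff, Ne, ← empty_mem_iff_bot, mem_curry_iff]
      simpa using fun x : ℕ => ⟨x, le_rfl⟩
    obtain ⟨q, hq1, hq2⟩ := Filter.nonempty_of_mem (inter_mem hF (hle (m + 1)))
    have := hm (mem_image_of_mem _ hq1)
    simp only [mem_ofPred_eq] at hq2
    omega)
  have hcol : ∀ m, (P ∩ {q | q.1 < m}).Finite := fun m =>
    (hPA _ ⟨Sum.inr ⟨m⟩, rfl⟩).subset fun q hq => ⟨hq.1, by simpa [C] using hq.2⟩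
  refine ⟨P, hcol, fun m => ?_, fun i => ?_⟩
  · by_contra! h
    exact hP ((hcol m).subset fun q hq => ⟨hq, h q hq⟩)
  · obtain ⟨m, hm⟩ := ((hPA _ ⟨Sum.inl i, rfl⟩).image Prod.fst).bddAbove
    refine ⟨m + 1, fun q hq hmq => ?_⟩
    by_contra hqA
    have := hm (mem_image_of_mem Prod.fst (show q ∈ P \ A i from ⟨hq, hqA⟩))
    omega

/-- Under Martin's Axiom, a sequence without cluster points in a regular first countable space
with fewer than `𝔠` points can be made to accumulate at a new point. -/
theorem MartinsAxiom.exists_trace (hMA : MartinsAxiom) {Y : Type u} {S : Set Y}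
    (hS : Cardinal.mk S < Cardinal.continuum) {B : Y → ℕ → Set Y} (hB : IsRegularBaseOn S B)
    {d : ℕ → Y} (hd : ∀ j, d j ∈ S) (hcl : ∀ y ∈ S, ∃ n, ∀ᶠ j in atTop, d j ∉ B y n) :
    ∃ W : ℕ → Set Y, (∀ k, W k ⊆ S) ∧ Antitone W ∧ IsTraceOn S B W ∧
      ∀ k, ∃ᶠ j in atTop, d j ∈ W k := by
  classical
  have hev : ∀ {p : ℕ → Prop}, (∀ᶠ j in atTop, p j) → ∀ᶠ j in (hyperfilter ℕ : Filter ℕ), p j :=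
    fun h => hyperfilter_le_cofinite (by rwa [Nat.cofinite_eq_atTop])
  -- A pair `(j, k)` stands for the ball `B (d j) k`. The ultrafilter decides between inclusion in
  -- `B y n` and disjointness from `B y (n + 1)`; this is what yields `sep`.
  let A : S × ℕ → Set (ℕ × ℕ) := fun i =>
    if ∀ᶠ j in (hyperfilter ℕ : Filter ℕ), d j ∈ B i.1 i.2 then
      {q | B (d q.1) q.2 ∩ S ⊆ B i.1 i.2}
    else {q | Disjoint (B (d q.1) q.2 ∩ S) (B i.1 (i.2 + 1))}
  have hcard : Cardinal.mk (S × ℕ) < Cardinal.continuum := by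
    rw [Cardinal.mk_prod, Cardinal.mk_nat, Cardinal.lift_aleph0]
    exact Cardinal.mul_lt_of_lt Cardinal.aleph0_le_continuum (by simpa using hS)
      Cardinal.aleph0_lt_continuum
  obtain ⟨P, hPfin, hPinf, hPA⟩ := hMA.exists_pseudoIntersection_curry hcard A (by
    rintro ⟨⟨y, hy⟩, n⟩
    rw [mem_curry_iff]
    by_cases h : ∀ᶠ j in (hyperfilter ℕ : Filter ℕ), d j ∈ B y n
    · filter_upwards [h] with j hj
      obtain ⟨m, hm⟩ := hB.isOpen y hy (d j) (hd j) n hj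
      filter_upwards [eventually_ge_atTop m] with k hk
      simp only [A, if_pos h, mem_ofPred_eq]
      exact fun z hz => hm ⟨hB.anti_le (hd j) hk hz, hz.2⟩
    · have h' := Ultrafilter.eventually_not.2 h
      filter_upwards [h'] with j hj
      obtain ⟨m, hm⟩ := hB.regular y hy (d j) (hd j) n hj
      filter_upwards [eventually_ge_atTop m] with k hk
      simp only [A, if_neg h, mem_ofPred_eq]
      exact Set.disjoint_left.2 fun z hz =>
        Set.disjoint_left.1 hm ⟨hB.anti_le (hd j) hk hz, hz.2⟩)
  have hneg : ∀ y ∈ S, ∃ n m, ∀ q ∈ P, m ≤ q.1 → Disjoint (B (d q.1) q.2 ∩ S) (B y n) := by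
    intro y hy
    obtain ⟨n, hn⟩ := hcl y hy
    have h : ¬ ∀ᶠ j in (hyperfilter ℕ : Filter ℕ), d j ∈ B y n :=
      Ultrafilter.eventually_not.1 (hev hn)
    obtain ⟨m, hm⟩ := hPA (⟨y, hy⟩, n)
    refine ⟨n + 1, m, fun q hq hmq => ?_⟩
    have := hm q hq hmq
    simpa only [A, if_neg h, mem_ofPred_eq] using this
  -- Raising `m` drops early columns and also shrinks every remaining ball. The shrinking is needed
  -- for `regular`, where the finitely many balls in early columns must be separated from a point
  -- outside `W k`.
  let W : ℕ → Set Y := fun m => {z | z ∈ S ∧ ∃ q ∈ P, m ≤ q.1 ∧ z ∈ B (d q.1) (q.2 + m)}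
  have hWd : ∀ m, ∀ q ∈ P, m ≤ q.1 → d q.1 ∈ W m := fun m q hq hmq =>
    ⟨hd _, q, hq, hmq, hB.mem _ (hd _) _⟩
  refine ⟨W, fun k z hz => hz.1, ?_, ?_, fun k => ?_⟩
  · rintro m m' hmm z ⟨hzS, q, hq, hmq, hz⟩
    exact ⟨hzS, q, hq, hmm.trans hmq, hB.anti_le (hd _) (by omega) ⟨hz, hzS⟩⟩
  · refine ⟨?_, ?_, ?_, ?_⟩
    · rintro z hz k ⟨-, q, hq, hkq, hzq⟩
      obtain ⟨m, hm⟩ := hB.isOpen _ (hd _) z hz _ hzq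
      exact ⟨m, fun w hw => ⟨hw.2, q, hq, hkq, hm hw⟩⟩
    · intro y hy n
      obtain ⟨m, hm⟩ := hPA (⟨y, hy⟩, n)
      by_cases h : ∀ᶠ j in (hyperfilter ℕ : Filter ℕ), d j ∈ B y n
      · refine Or.inl ⟨m, ?_⟩
        rintro z ⟨hzS, q, hq, hmq, hz⟩
        have := hm q hq hmq
        simp only [A, if_pos h, mem_ofPred_eq] at this
        exact this ⟨hB.anti_le (hd _) (Nat.le_add_right _ _) ⟨hz, hzS⟩, hzS⟩
      · refine Or.inr ⟨m, Set.disjoint_left.2 ?_⟩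
        rintro z ⟨hzS, q, hq, hmq, hz⟩
        have := hm q hq hmq
        simp only [A, if_neg h, mem_ofPred_eq] at this
        exact Set.disjoint_left.1 this
          ⟨hB.anti_le (hd _) (Nat.le_add_right _ _) ⟨hz, hzS⟩, hzS⟩
    · intro y hy
      obtain ⟨n, m, hm⟩ := hneg y hy
      refine ⟨n, m, Set.disjoint_left.2 ?_⟩
      rintro z ⟨hzS, q, hq, hmq, hz⟩
      exact Set.disjoint_left.1 (hm q hq hmq)
        ⟨hB.anti_le (hd _) (Nat.le_add_right _ _) ⟨hz, hzS⟩, hzS⟩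
    · intro k y hy hyk
      obtain ⟨n, m, hm⟩ := hneg y hy
      have hfar : ∀ q ∈ P, k ≤ q.1 → ∃ r, Disjoint (B y r ∩ S) (B (d q.1) (q.2 + k + 1)) :=
        fun q hq hkq => hB.regular _ (hd _) y hy _ fun h => hyk ⟨hy, q, hq, hkq, h⟩
      choose! r hr using hfar
      -- Columns from `m` on are avoided by the single set `B y n`; before `m` only finitely many
      -- balls remain, so one index `b` serves them all.
      obtain ⟨b, hb⟩ := ((hPfin m).image r).bddAbove
      refine ⟨max n b, Set.disjoint_left.2 ?_⟩
      rintro z ⟨hzy, hzS⟩ ⟨-, q, hq, hkq, hz⟩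
      rcases le_or_gt m q.1 with hmq | hmq
      · exact Set.disjoint_left.1 (hm q hq hmq)
          ⟨hB.anti_le (hd _) (Nat.le_add_right _ _) ⟨hz, hzS⟩, hzS⟩
          (hB.anti_le hy (le_max_left _ _) ⟨hzy, hzS⟩)
      · have hrb : r q ≤ b := hb (mem_image_of_mem _ ⟨hq, hmq⟩)
        exact Set.disjoint_left.1 (hr q hq (by omega))
          ⟨hB.anti_le hy (hrb.trans (le_max_right _ _)) ⟨hzy, hzS⟩, hzS⟩ hz
  · rw [frequently_atTop]
    intro N
    obtain ⟨q, hq, hkq⟩ := hPinf (max N k)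
    exact ⟨q.1, (le_max_left _ _).trans hkq, hWd k q hq ((le_max_right _ _).trans hkq)⟩

/-! ### Admissible data for a new point -/

theorem exists_wellFounded_recursion {I D : Type*} [LT I] [WellFoundedLT I]
    (Spec : ∀ i : I, (∀ j, j < i → D) → D → Prop) (h : ∀ i f, ∃ d, Spec i f d) :
    ∃ F : I → D, ∀ i, Spec i (fun j _ => F j) (F i) := by
  choose g hg using h
  refine ⟨wellFounded_lt.fix g, fun i => ?_⟩
  rw [wellFounded_lt.fix_eq]
  exact hg i _

/-- The data attached to a new point: the traces of its basic neighbourhoods on the earlier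
points, and the earlier basic neighbourhoods (given by centre and index) it is put into. -/
structure NewPoint (Y : Type u) where
  /-- the traces of the basic neighbourhoods -/
  trace : ℕ → Set Y
  /-- the earlier basic neighbourhoods which contain the new point -/
  above : Set (Y × ℕ)

/-- The requirements on the data of a new point, added to the space `S` with neighbourhood bases
`B` in order to provide the sequence `s` with a cluster point. -/
structure NewPoint.IsAdmissible {Y : Type u} (S : Set Y) (B : Y → ℕ → Set Y) (s : ℕ → Y)
    (d : NewPoint Y) : Prop where
  subset : ∀ k, d.trace k ⊆ S
  anti : Antitone d.trace
  mem_above : ∀ y ∈ S, ∀ n,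
    (y, n) ∈ d.above ↔ (∀ k, (d.trace k).Nonempty) ∧ ∃ k, d.trace k ⊆ B y n
  isTraceOn : IsRegularBaseOn S B → IsTraceOn S B d.trace
  cluster : IsRegularBaseOn S B → (∀ j, s j ∈ S) →
    (∃ y ∈ S, ∀ n, ∃ᶠ j in atTop, s j ∈ B y n) ∨ ∀ k, ∃ᶠ j in atTop, s j ∈ d.trace k

theorem NewPoint.IsAdmissible.congr {Y : Type u} {S : Set Y} {B B' : Y → ℕ → Set Y} {s : ℕ → Y}
    {d : NewPoint Y} (hd : d.IsAdmissible S B s)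
    (h : ∀ y ∈ S, ∀ n, ∀ z ∈ S, z ∈ B y n ↔ z ∈ B' y n) : d.IsAdmissible S B' s where
  subset := hd.subset
  anti := hd.anti
  mem_above y hy n := by
    rw [hd.mem_above y hy n]
    refine and_congr_right fun _ => exists_congr fun k => ?_
    exact forall₂_congr fun z hz => h y hy n z (hd.subset k hz)
  isTraceOn hB := (hd.isTraceOn (hB.congr fun y hy n z hz => (h y hy n z hz).symm)).congr
    hd.subset h
  cluster hB hs := by
    refine (hd.cluster (hB.congr fun y hy n z hz => (h y hy n z hz).symm) hs).imp_left ?_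
    rintro ⟨y, hy, hyc⟩
    exact ⟨y, hy, fun n => (hyc n).mono fun j hj => (h y hy n _ (hs j)).1 hj⟩

/-- Regularity of the stage is a premise inside admissibility, so data exist for arbitrary `B`. The
recursion can thus be run first and regularity proved afterwards by induction. -/
theorem MartinsAxiom.exists_isAdmissible (hMA : MartinsAxiom) {Y : Type u} {S : Set Y}
    (hS : Cardinal.mk S < Cardinal.continuum) (B : Y → ℕ → Set Y) (s : ℕ → Y) :
    ∃ d : NewPoint Y, d.IsAdmissible S B s := by
  suffices h : ∃ W : ℕ → Set Y, (∀ k, W k ⊆ S) ∧ Antitone W ∧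
      (IsRegularBaseOn S B → IsTraceOn S B W) ∧ (IsRegularBaseOn S B → (∀ j, s j ∈ S) →
        (∃ y ∈ S, ∀ n, ∃ᶠ j in atTop, s j ∈ B y n) ∨ ∀ k, ∃ᶠ j in atTop, s j ∈ W k) by
    obtain ⟨W, h1, h2, h3, h4⟩ := h
    exact ⟨⟨W, {q | (∀ k, (W k).Nonempty) ∧ ∃ k, W k ⊆ B q.1 q.2}⟩, h1, h2,
      fun y _ n => Iff.rfl, h3, h4⟩
  by_cases h : IsRegularBaseOn S B ∧ (∀ j, s j ∈ S) ∧
      ¬ ∃ y ∈ S, ∀ n, ∃ᶠ j in atTop, s j ∈ B y n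
  · obtain ⟨hB, hs, hc⟩ := h
    obtain ⟨W, h1, h2, h3, h4⟩ := hMA.exists_trace hS hB hs (by
      intro y hy
      by_contra! hcon
      exact hc ⟨y, hy, fun n => by simpa [Filter.Frequently] using hcon n⟩)
    exact ⟨W, h1, h2, fun _ => h3, fun _ _ => Or.inr h4⟩
  -- When no cluster point is needed, empty traces add an isolated point. The nonemptiness clause in
  -- `mem_above` keeps it out of all earlier balls.
  · refine ⟨fun _ => ∅, fun _ => empty_subset _, antitone_const, fun _ => ?_, fun hB hs => ?_⟩
    · exact ⟨by simp, by simp, by simp, by simp⟩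
    · by_contra hcon
      exact h ⟨hB, hs, fun hc => hcon (Or.inl hc)⟩

/-! ### Neighbourhoods in the extension and the transfinite recursion -/

section extension

variable {X I : Type u}

/-- The points of `X` and the new points with index in `J`. -/
def extensionStage (X : Type u) {I : Type u} (J : Set I) : Set (X ⊕ I) :=
  range Sum.inl ∪ Sum.inr '' J

@[simp] theorem inl_mem_extensionStage {x : X} {J : Set I} :
    (Sum.inl x : X ⊕ I) ∈ extensionStage X J := Or.inl ⟨x, rfl⟩

@[simp] theorem inr_mem_extensionStage {i : I} {J : Set I} :
    (Sum.inr i : X ⊕ I) ∈ extensionStage X J ↔ i ∈ J := by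
  simp [extensionStage]

theorem extensionStage_mono {J K : Set I} (h : J ⊆ K) :
    extensionStage X J ⊆ extensionStage X K :=
  union_subset_union_right _ (image_mono h)

variable [LinearOrder I]

/-- The basic neighbourhoods in `X ⊕ I` determined by neighbourhood bases in `X` and the data of
the new points. -/
def extensionBall (V : X → ℕ → Set X) (F : I → NewPoint (X ⊕ I)) (y : X ⊕ I) (n : ℕ) :
    Set (X ⊕ I) :=
  Sum.elim (fun x => Sum.inl '' V x n) (fun j => insert (Sum.inr j) ((F j).trace n)) y ∪
    Sum.inr '' {i | y ∈ extensionStage X (Iio i) ∧ (y, n) ∈ (F i).above}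

variable {V : X → ℕ → Set X} {F F' : I → NewPoint (X ⊕ I)}

/-- The trace of the balls on a stage depends only on the data chosen before it; this makes the
recursion well defined. -/
theorem mem_extensionBall_congr {i : I} (h : ∀ j < i, F j = F' j) {y z : X ⊕ I}
    (hy : y ∈ extensionStage X (Iio i)) (hz : z ∈ extensionStage X (Iio i)) (n : ℕ) :
    z ∈ extensionBall V F y n ↔ z ∈ extensionBall V F' y n := by
  refine or_congr ?_ ?_
  · rcases y with x | j
    · rfl
    · rw [inr_mem_extensionStage] at hy
      simp [h j hy]
  · rcases z with x | j
    · simp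
    · rw [inr_mem_extensionStage] at hz
      simp [h j hz]

theorem inl_mem_extensionBall_inl {x x' : X} {n : ℕ} :
    (Sum.inl x' : X ⊕ I) ∈ extensionBall V F (Sum.inl x) n ↔ x' ∈ V x n := by
  simp [extensionBall]

theorem mem_extensionBall_inr {j : I} {n : ℕ} {z : X ⊕ I} (hz : z ∈ extensionStage X (Iio j)) :
    z ∈ extensionBall V F (Sum.inr j) n ↔ z ∈ (F j).trace n := by
  rcases z with x | i
  · simp [extensionBall]
  · rw [inr_mem_extensionStage, mem_Iio] at hz
    simp [extensionBall, hz.ne, hz.le]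

theorem inr_mem_extensionBall_self {j : I} {n : ℕ} :
    (Sum.inr j : X ⊕ I) ∈ extensionBall V F (Sum.inr j) n := by
  simp [extensionBall]

theorem inr_mem_extensionBall (hF : ∀ i k, (F i).trace k ⊆ extensionStage X (Iio i)) {i : I}
    {y : X ⊕ I} (hy : y ∈ extensionStage X (Iio i)) {n : ℕ} :
    Sum.inr i ∈ extensionBall V F y n ↔ (y, n) ∈ (F i).above := by
  rcases y with x | j
  · simp [extensionBall]
  · have hj : j < i := by simpa using hy
    have : Sum.inr i ∉ (F j).trace n := fun h => by
      have := hF j n h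
      simp only [inr_mem_extensionStage, mem_Iio] at this
      exact lt_asymm hj this
    simp [extensionBall, this, hj.ne', hj]

/-- Under Martin's Axiom, all the new points can be given admissible data. -/
theorem MartinsAxiom.exists_admissible_family (hMA : MartinsAxiom) [WellFoundedLT I]
    (hI : ∀ i : I, Cardinal.mk (extensionStage X (Iio i)) < Cardinal.continuum)
    (V : X → ℕ → Set X) (s : I → ℕ → X ⊕ I) :
    ∃ F : I → NewPoint (X ⊕ I), ∀ i,
      (F i).IsAdmissible (extensionStage X (Iio i)) (extensionBall V F) (s i) := by
  classical
  obtain ⟨F, hF⟩ := exists_wellFounded_recursion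
    (fun (i : I) (f : ∀ j, j < i → NewPoint (X ⊕ I)) d =>
      d.IsAdmissible (extensionStage X (Iio i))
        -- The default value for `j ≥ i` is irrelevant, by `mem_extensionBall_congr`.
        (extensionBall V fun j => if h : j < i then f j h else ⟨fun _ => ∅, ∅⟩) (s i))
    (fun i f => hMA.exists_isAdmissible (hI i) _ _)
  exact ⟨F, fun i => (hF i).congr fun y hy n z hz =>
    mem_extensionBall_congr (fun j hj => by simp [hj]) hy hz n⟩

end extension

/-! ### Persistence and regularity of all stages -/

section extension

variable {X I : Type u} [LinearOrder I] [WellFoundedLT I] {V : X → ℕ → Set X}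
  {F : I → NewPoint (X ⊕ I)} {s : I → ℕ → X ⊕ I}

theorem extensionStage_induction {J : Set I} {p : X ⊕ I → Prop}
    (h : ∀ z ∈ extensionStage X J, p z)
    (hp : ∀ i ∉ J, (∀ z ∈ extensionStage X (Iio i), p z) → p (Sum.inr i)) (z : X ⊕ I) : p z := by
  rcases z with x | i
  · exact h _ inl_mem_extensionStage
  · induction i using WellFoundedLT.induction with
    | ind i ih =>
      by_cases hi : i ∈ J
      · exact h _ (inr_mem_extensionStage.2 hi)
      · refine hp i hi ?_
        rintro (x | _) hz
        · exact h _ inl_mem_extensionStage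
        · exact ih _ (by simpa using hz)

omit [WellFoundedLT I] in
theorem extensionStage_subset_of_notMem {J : Set I} (hJ : IsLowerSet J) {i : I} (hi : i ∉ J) :
    extensionStage X J ⊆ extensionStage X (Iio i) :=
  extensionStage_mono fun _ hj => lt_of_not_ge fun hij => hi (hJ hij hj)

omit [WellFoundedLT I] in
theorem mem_extensionStage_Iic {j : I} {y : X ⊕ I} (hy : y ∈ extensionStage X (Iic j)) :
    y = Sum.inr j ∨ y ∈ extensionStage X (Iio j) := by
  rcases y with x | i
  · exact Or.inr inl_mem_extensionStage
  · rcases (show i ≤ j by simpa using hy).eq_or_lt with rfl | h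
    · exact Or.inl rfl
    · exact Or.inr (by simpa using h)

/-- Inclusions between basic sets persist from a stage on. -/
theorem extensionBall_subset_of_stage
    (hF : ∀ i, (F i).IsAdmissible (extensionStage X (Iio i)) (extensionBall V F) (s i))
    {J : Set I} (hJ : IsLowerSet J) {y z : X ⊕ I} (hy : y ∈ extensionStage X J)
    (hz : z ∈ extensionStage X J) {m n : ℕ}
    (h : extensionBall V F z m ∩ extensionStage X J ⊆ extensionBall V F y n) :
    extensionBall V F z m ⊆ extensionBall V F y n := by
  intro w
  induction w using extensionStage_induction (J := J) with
  | h w hw => exact fun hw' => h ⟨hw', hw⟩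
  | hp i hi ih =>
    have hsub := extensionStage_subset_of_notMem (X := X) hJ hi
    rw [inr_mem_extensionBall (fun i => (hF i).subset) (hsub hz),
      inr_mem_extensionBall (fun i => (hF i).subset) (hsub hy),
      (hF i).mem_above z (hsub hz), (hF i).mem_above y (hsub hy)]
    -- A later point enters a ball exactly when one of its traces lies in it and none is empty; by
    -- induction that trace also lies in the larger ball.
    rintro ⟨hne, k, hk⟩
    exact ⟨hne, k, fun w hw => ih w ((hF i).subset k hw) (hk hw)⟩

/-- Disjointness of basic sets persists from a stage on. -/
theorem disjoint_extensionBall_of_stage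
    (hF : ∀ i, (F i).IsAdmissible (extensionStage X (Iio i)) (extensionBall V F) (s i))
    {J : Set I} (hJ : IsLowerSet J) {y z : X ⊕ I} (hy : y ∈ extensionStage X J)
    (hz : z ∈ extensionStage X J) {m n : ℕ}
    (h : Disjoint (extensionBall V F z m ∩ extensionStage X J) (extensionBall V F y n)) :
    Disjoint (extensionBall V F z m) (extensionBall V F y n) := by
  rw [Set.disjoint_left]
  intro w
  induction w using extensionStage_induction (J := J) with
  | h w hw => exact fun hw' => Set.disjoint_left.1 h ⟨hw', hw⟩
  | hp i hi ih =>
    have hsub := extensionStage_subset_of_notMem (X := X) hJ hi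
    rw [inr_mem_extensionBall (fun i => (hF i).subset) (hsub hz),
      inr_mem_extensionBall (fun i => (hF i).subset) (hsub hy),
      (hF i).mem_above z (hsub hz), (hF i).mem_above y (hsub hy)]
    -- A later point in both balls would put a nonempty trace, hence an earlier point, into both.
    rintro ⟨hne, k, hk⟩ ⟨-, l, hl⟩
    obtain ⟨w, hw⟩ := hne (max k l)
    exact ih w ((hF i).subset _ hw) (hk ((hF i).anti (le_max_left k l) hw))
      (hl ((hF i).anti (le_max_right k l) hw))

omit [WellFoundedLT I] in
theorem inr_notMem_extensionBall_of_disjoint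
    (hF : ∀ i, (F i).IsAdmissible (extensionStage X (Iio i)) (extensionBall V F) (s i))
    {j : I} {y : X ⊕ I} (hy : y ∈ extensionStage X (Iio j)) {n k : ℕ}
    (h : Disjoint ((F j).trace k) (extensionBall V F y n)) :
    Sum.inr j ∉ extensionBall V F y n := by
  rw [inr_mem_extensionBall (fun i => (hF i).subset) hy, (hF j).mem_above y hy]
  rintro ⟨hne, l, hl⟩
  obtain ⟨w, hw⟩ := hne (max k l)
  exact Set.disjoint_left.1 h ((hF j).anti (le_max_left k l) hw)
    (hl ((hF j).anti (le_max_right k l) hw))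

/-- Successor step. Relations between old balls persist; the cases mixing an old point with the new
one come from the clauses of `IsTraceOn` and from `mem_above`. -/
theorem isRegularBaseOn_Iic
    (hF : ∀ i, (F i).IsAdmissible (extensionStage X (Iio i)) (extensionBall V F) (s i)) {j : I}
    (hB : IsRegularBaseOn (extensionStage X (Iio j)) (extensionBall V F)) :
    IsRegularBaseOn (extensionStage X (Iic j)) (extensionBall V F) := by
  have hT := (hF j).isTraceOn hB
  have hanti : ∀ y ∈ extensionStage X (Iio j), Antitone (extensionBall V F y) := fun y hy =>
    antitone_nat_of_succ_le fun n =>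
      extensionBall_subset_of_stage hF (isLowerSet_Iio j) hy hy (hB.anti y hy n)
  refine ⟨fun y hy n => ?_, fun y hy n => ?_, fun y hy z hz n h => ?_, fun y hy z hz h => ?_,
    fun y hy z hz n h => ?_⟩
  · rcases mem_extensionStage_Iic hy with rfl | hy
    · exact inr_mem_extensionBall_self
    · exact hB.mem y hy n
  · rcases mem_extensionStage_Iic hy with rfl | hy
    · rintro z ⟨hz, hzT⟩
      rcases mem_extensionStage_Iic hzT with rfl | hzS
      · exact inr_mem_extensionBall_self
      · rw [mem_extensionBall_inr hzS] at hz ⊢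
        exact (hF j).anti n.le_succ hz
    · exact inter_subset_left.trans (hanti y hy n.le_succ)
  · rcases mem_extensionStage_Iic hy with rfl | hy <;>
      rcases mem_extensionStage_Iic hz with rfl | hz
    · exact ⟨n, inter_subset_left⟩
    · rw [mem_extensionBall_inr hz] at h
      obtain ⟨m, hm⟩ := hT.isOpen z hz n h
      refine ⟨m, fun w hw => ?_⟩
      rcases mem_extensionStage_Iic hw.2 with rfl | hwS
      · exact inr_mem_extensionBall_self
      · exact (mem_extensionBall_inr hwS).2 (hm ⟨hw.1, hwS⟩)
    · have h' := h
      rw [inr_mem_extensionBall (fun i => (hF i).subset) hy, (hF j).mem_above y hy] at h'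
      obtain ⟨-, k, hk⟩ := h'
      refine ⟨k, fun w hw => ?_⟩
      rcases mem_extensionStage_Iic hw.2 with rfl | hwS
      · exact h
      · exact hk ((mem_extensionBall_inr hwS).1 hw.1)
    · obtain ⟨m, hm⟩ := hB.isOpen y hy z hz n h
      exact ⟨m, inter_subset_left.trans
        (extensionBall_subset_of_stage hF (isLowerSet_Iio j) hy hz hm)⟩
  · rcases mem_extensionStage_Iic hy with rfl | hy <;>
      rcases mem_extensionStage_Iic hz with rfl | hz
    · exact absurd rfl h
    · obtain ⟨n, k, hk⟩ := hT.avoid z hz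
      refine ⟨k, fun hzk => ?_⟩
      exact Set.disjoint_left.1 hk ((mem_extensionBall_inr hz).1 hzk) (hB.mem z hz n)
    · obtain ⟨n, k, hk⟩ := hT.avoid y hy
      exact ⟨n, inr_notMem_extensionBall_of_disjoint hF hy hk⟩
    · exact hB.t1 y hy z hz h
  · rcases mem_extensionStage_Iic hy with rfl | hy <;>
      rcases mem_extensionStage_Iic hz with rfl | hz
    · exact absurd inr_mem_extensionBall_self h
    · rw [mem_extensionBall_inr hz] at h
      obtain ⟨m, hm⟩ := hT.regular n z hz h
      obtain ⟨l, k, hk⟩ := hT.avoid z hz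
      -- Index `m` keeps the ball off the trace, and `l` keeps the new point itself out of the ball.
      refine ⟨max m l, Set.disjoint_left.2 fun w hw hw' => ?_⟩
      rcases mem_extensionStage_Iic hw.2 with rfl | hwS
      · exact inr_notMem_extensionBall_of_disjoint hF hz hk (hanti z hz (le_max_right m l) hw.1)
      · exact Set.disjoint_left.1 hm ⟨hanti z hz (le_max_left m l) hw.1, hwS⟩
          ((mem_extensionBall_inr hwS).1 hw')
    · have hj : Sum.inr j ∉ extensionBall V F y (n + 1) := fun h' => h (hanti y hy n.le_succ h')
      obtain ⟨k, hk⟩ : ∃ k, Disjoint ((F j).trace k) (extensionBall V F y (n + 1)) := by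
        rcases hT.sep y hy n with ⟨k, hk⟩ | h'
        · rw [inr_mem_extensionBall (fun i => (hF i).subset) hy, (hF j).mem_above y hy] at h
          -- A trace lies in `B y n` although the new point does not, so some trace is empty and
          -- disjointness is trivial.
          have : ¬ ∀ k, ((F j).trace k).Nonempty := fun hne => h ⟨hne, k, hk⟩
          obtain ⟨l, hl⟩ := not_forall.1 this
          exact ⟨l, by simp [Set.not_nonempty_iff_eq_empty.1 hl]⟩
        · exact h'
      refine ⟨k, Set.disjoint_left.2 fun w hw hw' => ?_⟩
      rcases mem_extensionStage_Iic hw.2 with rfl | hwS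
      · exact hj hw'
      · exact Set.disjoint_left.1 hk ((mem_extensionBall_inr hwS).1 hw.1) hw'
    · obtain ⟨m, hm⟩ := hB.regular y hy z hz n h
      exact ⟨m, (disjoint_extensionBall_of_stage hF (isLowerSet_Iio j) hy hz hm).mono_left
        inter_subset_left⟩

omit [WellFoundedLT I] in
theorem isRegularBaseOn_empty (hV : IsRegularBaseOn univ V) :
    IsRegularBaseOn (extensionStage X ∅) (extensionBall V F) := by
  have hS : extensionStage X (∅ : Set I) = range Sum.inl := by simp [extensionStage]
  rw [hS]
  refine ⟨?_, ?_, ?_, ?_, ?_⟩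
  · rintro _ ⟨x, rfl⟩ n
    exact inl_mem_extensionBall_inl.2 (hV.mem x trivial n)
  · rintro _ ⟨x, rfl⟩ n _ ⟨hz, z, rfl⟩
    rw [inl_mem_extensionBall_inl] at hz ⊢
    exact hV.anti x trivial n ⟨hz, trivial⟩
  · rintro _ ⟨x, rfl⟩ _ ⟨z, rfl⟩ n h
    obtain ⟨m, hm⟩ := hV.isOpen x trivial z trivial n (inl_mem_extensionBall_inl.1 h)
    refine ⟨m, ?_⟩
    rintro _ ⟨hw, w, rfl⟩
    exact inl_mem_extensionBall_inl.2 (hm ⟨inl_mem_extensionBall_inl.1 hw, trivial⟩)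
  · rintro _ ⟨x, rfl⟩ _ ⟨z, rfl⟩ h
    obtain ⟨n, hn⟩ := hV.t1 x trivial z trivial fun h' => h (congrArg _ h')
    exact ⟨n, fun h' => hn (inl_mem_extensionBall_inl.1 h')⟩
  · rintro _ ⟨x, rfl⟩ _ ⟨z, rfl⟩ n h
    obtain ⟨m, hm⟩ := hV.regular x trivial z trivial n fun h' => h (inl_mem_extensionBall_inl.2 h')
    refine ⟨m, Set.disjoint_left.2 ?_⟩
    rintro _ ⟨hw, w, rfl⟩ hw'
    exact Set.disjoint_left.1 hm ⟨inl_mem_extensionBall_inl.1 hw, trivial⟩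
      (inl_mem_extensionBall_inl.1 hw')

/-- Limit step. Each requirement concerns at most two points, which lie together in the initial
stage or in some `Iic j` with `j ∈ J`; the inclusions and disjointness found there persist. -/
theorem isRegularBaseOn_of_Iic
    (hF : ∀ i, (F i).IsAdmissible (extensionStage X (Iio i)) (extensionBall V F) (s i))
    (hV : IsRegularBaseOn univ V) {J : Set I}
    (h : ∀ j ∈ J, IsRegularBaseOn (extensionStage X (Iic j)) (extensionBall V F)) :
    IsRegularBaseOn (extensionStage X J) (extensionBall V F) := by
  have key : ∀ y ∈ extensionStage X J, ∀ z ∈ extensionStage X J, ∃ K : Set I, IsLowerSet K ∧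
      y ∈ extensionStage X K ∧ z ∈ extensionStage X K ∧
      IsRegularBaseOn (extensionStage X K) (extensionBall V F) := by
    rintro (x | i) hy (x' | j) hz
    · exact ⟨∅, isLowerSet_empty, inl_mem_extensionStage, inl_mem_extensionStage,
        isRegularBaseOn_empty hV⟩
    · exact ⟨Iic j, isLowerSet_Iic j, by simp, by simp, h j (by simpa using hz)⟩
    · exact ⟨Iic i, isLowerSet_Iic i, by simp, by simp, h i (by simpa using hy)⟩
    · rcases le_total i j with hij | hij
      · exact ⟨Iic j, isLowerSet_Iic j, by simpa, by simp, h j (by simpa using hz)⟩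
      · exact ⟨Iic i, isLowerSet_Iic i, by simp, by simpa, h i (by simpa using hy)⟩
  refine ⟨fun y hy n => ?_, fun y hy n => ?_, fun y hy z hz n hn => ?_, fun y hy z hz hn => ?_,
    fun y hy z hz n hn => ?_⟩
  · obtain ⟨K, -, hyK, -, hK⟩ := key y hy y hy
    exact hK.mem y hyK n
  · obtain ⟨K, hKl, hyK, -, hK⟩ := key y hy y hy
    exact inter_subset_left.trans
      (extensionBall_subset_of_stage hF hKl hyK hyK (hK.anti y hyK n))
  · obtain ⟨K, hKl, hyK, hzK, hK⟩ := key y hy z hz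
    obtain ⟨m, hm⟩ := hK.isOpen y hyK z hzK n hn
    exact ⟨m, inter_subset_left.trans (extensionBall_subset_of_stage hF hKl hyK hzK hm)⟩
  · obtain ⟨K, hKl, hyK, hzK, hK⟩ := key y hy z hz
    exact hK.t1 y hyK z hzK hn
  · obtain ⟨K, hKl, hyK, hzK, hK⟩ := key y hy z hz
    obtain ⟨m, hm⟩ := hK.regular y hyK z hzK n hn
    exact ⟨m, (disjoint_extensionBall_of_stage hF hKl hyK hzK hm).mono_left inter_subset_left⟩

theorem isRegularBaseOn_Iio
    (hF : ∀ i, (F i).IsAdmissible (extensionStage X (Iio i)) (extensionBall V F) (s i))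
    (hV : IsRegularBaseOn univ V) (i : I) :
    IsRegularBaseOn (extensionStage X (Iio i)) (extensionBall V F) := by
  induction i using WellFoundedLT.induction with
  | ind i ih =>
    exact isRegularBaseOn_of_Iic hF hV fun j hj => isRegularBaseOn_Iic hF (ih j hj)

theorem isRegularBaseOn_univ_extensionBall
    (hF : ∀ i, (F i).IsAdmissible (extensionStage X (Iio i)) (extensionBall V F) (s i))
    (hV : IsRegularBaseOn univ V) : IsRegularBaseOn univ (extensionBall V F) := by
  have h := isRegularBaseOn_of_Iic (J := univ) hF hV fun j _ =>
    isRegularBaseOn_Iic hF (isRegularBaseOn_Iio hF hV j)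
  have hu : extensionStage X (univ : Set I) = univ := by
    simp [extensionStage, Set.range_inl_union_range_inr]
  rwa [hu] at h

theorem exists_cluster_extensionBall
    (hF : ∀ i, (F i).IsAdmissible (extensionStage X (Iio i)) (extensionBall V F) (s i))
    (hV : IsRegularBaseOn univ V) {i : I} (hi : ∀ j, s i j ∈ extensionStage X (Iio i)) :
    ∃ y, ∀ n, ∃ᶠ j in atTop, s i j ∈ extensionBall V F y n := by
  rcases (hF i).cluster (isRegularBaseOn_Iio hF hV i) hi with ⟨y, -, hy⟩ | h
  · exact ⟨y, hy⟩
  · exact ⟨Sum.inr i, fun n => (h n).mono fun j hj => (mem_extensionBall_inr (hi j)).2 hj⟩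

end extension

/-! ### Listing all sequences in length `𝔠` -/

section bookkeeping

open Cardinal

/-- By König's theorem the cofinality of `𝔠 = 2 ^ ℵ₀` is uncountable, so a countable set of indices
is bounded. -/
theorem exists_forall_lt_of_countable (r : ℕ → continuum.{u}.ord.ToType) :
    ∃ i, ∀ n, r n < i := by
  have h : ¬ IsCofinal (range r) := by
    intro h
    have h1 := Order.cof_le h
    rw [Ordinal.cof_toType] at h1
    have h2 : ℵ₀ < continuum.{u}.ord.cof := by
      rw [← two_power_aleph0]
      exact Cardinal.lt_cof_ord_power le_rfl one_lt_two
    exact absurd (h2.trans_le h1) (not_lt.2 (countable_range r).le_aleph0)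
  simp only [IsCofinal, not_forall, not_exists, not_and, not_le] at h
  obtain ⟨i, hi⟩ := h
  exact ⟨i, fun n => hi _ (mem_range_self n)⟩

theorem mk_extensionStage_Iio_lt {X : Type u} (hX : #X < continuum)
    (i : continuum.{u}.ord.ToType) : #(extensionStage X (Iio i)) < continuum := by
  refine (mk_union_le _ _).trans_lt (add_lt_of_lt aleph0_le_continuum ?_ ?_)
  · exact mk_range_le.trans_lt hX
  · exact mk_image_le.trans_lt (by simpa using mk_Iio_lt i)

/-- Every sequence in `X ⊕ 𝔠` is listed at a stage at which all of its terms are present. -/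
theorem exists_bookkeeping {X : Type u} (hX : #X < continuum) :
    ∃ s : continuum.{u}.ord.ToType → ℕ → X ⊕ continuum.{u}.ord.ToType,
      ∀ t, ∃ i, s i = t ∧ ∀ j, t j ∈ extensionStage X (Iio i) := by
  set I := continuum.{u}.ord.ToType
  have hI : #I = continuum := by simp [I]
  have hY : #(ℕ → X ⊕ I) = continuum := by
    have : #(X ⊕ I) = continuum := by
      rw [mk_sum, lift_id, lift_id, hI]
      exact add_eq_right aleph0_le_continuum hX.le
    simp [this, -mk_sum]
  have hprod : #I = #(I × (ℕ → X ⊕ I)) := by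
    rw [mk_prod, lift_id, lift_id, hI, hY, continuum_mul_self]
  obtain ⟨e⟩ := Cardinal.eq.1 hprod
  refine ⟨fun i => (e i).2, fun t => ?_⟩
  obtain ⟨i₀, hi₀⟩ : ∃ i₀ : I, ∀ j, t j ∈ extensionStage X (Iio i₀) := by
    have hne : Nonempty I := by
      rw [← mk_ne_zero_iff, hI]
      exact continuum_ne_zero
    obtain ⟨i, hi⟩ := exists_forall_lt_of_countable
      fun n => Sum.elim (fun _ => Classical.arbitrary I) id (t n)
    refine ⟨i, fun j => ?_⟩
    have := hi j
    rcases h : t j with x | k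
    · simp
    · simpa [h] using this
  have hinj : Function.Injective fun k : I => e.symm (k, t) := fun k l h => by
    simpa using e.symm.injective h
  -- The sequence `t` is listed `𝔠` times, while fewer than `𝔠` indices lie below `i₀`.
  obtain ⟨k, hk⟩ : ∃ k : I, i₀ ≤ e.symm (k, t) := by
    by_contra! h
    have h1 : #I ≤ #(Iio i₀) :=
      mk_le_of_injective (f := fun k : I => (⟨e.symm (k, t), h k⟩ : Iio i₀)) fun k l hkl =>
        hinj (congrArg Subtype.val hkl)
    rw [hI] at h1
    exact absurd (by simpa [I] using mk_Iio_lt i₀) (not_lt.2 h1)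
  exact ⟨e.symm (k, t), by simp, fun j => extensionStage_mono (Iio_subset_Iio hk) (hi₀ j)⟩

end bookkeeping

/-! ### Passing between bases and topologies; the countably compact extension -/

/-- A first countable regular space has neighbourhood bases as in `IsRegularBaseOn`. -/
theorem exists_isRegularBaseOn_nhds (X : Type u) [TopologicalSpace X] [T3Space X]
    [FirstCountableTopology X] :
    ∃ V : X → ℕ → Set X, IsRegularBaseOn univ V ∧ ∀ x, (𝓝 x).HasBasis (fun _ => True) (V x) := by
  have hstep : ∀ (x : X) (U : Set X), U ∈ 𝓝 x → ∃ W, IsOpen W ∧ x ∈ W ∧ closure W ⊆ U := by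
    intro x U hU
    obtain ⟨C, hC, hCc, hCU⟩ := exists_mem_nhds_isClosed_subset hU
    exact ⟨interior C, isOpen_interior, mem_interior_iff_mem_nhds.2 hC,
      (closure_minimal interior_subset hCc).trans hCU⟩
  have hx : ∀ x : X, ∃ W : ℕ → Set X, (∀ n, IsOpen (W n)) ∧ (∀ n, x ∈ W n) ∧
      (∀ n, closure (W (n + 1)) ⊆ W n) ∧ (𝓝 x).HasBasis (fun _ => True) W := by
    intro x
    obtain ⟨b, hb⟩ := (𝓝 x).exists_antitone_basis
    choose! g hgo hgx hgc using hstep x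
    let W : ℕ → Set X := fun n => Nat.rec (g (b 0)) (fun n U => g (U ∩ b (n + 1))) n
    have hWn : ∀ n, W n ∈ 𝓝 x := by
      intro n
      induction n with
      | zero => exact (hgo _ (hb.mem 0)).mem_nhds (hgx _ (hb.mem 0))
      | succ n ih =>
        have := inter_mem ih (hb.mem (n + 1))
        exact (hgo _ this).mem_nhds (hgx _ this)
    have hsucc : ∀ n, closure (W (n + 1)) ⊆ W n ∩ b (n + 1) := fun n =>
      hgc _ (inter_mem (hWn n) (hb.mem (n + 1)))
    refine ⟨W, fun n => ?_, fun n => mem_of_mem_nhds (hWn n),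
      fun n => (hsucc n).trans inter_subset_left, ?_⟩
    · cases n with
      | zero => exact hgo _ (hb.mem 0)
      | succ n => exact hgo _ (inter_mem (hWn n) (hb.mem (n + 1)))
    · refine ⟨fun U => ⟨fun hU => ?_, fun ⟨n, _, hn⟩ => mem_of_superset (hWn n) hn⟩⟩
      obtain ⟨n, hn⟩ := hb.mem_iff.1 hU
      exact ⟨n + 1, trivial, subset_closure.trans ((hsucc n).trans
        (inter_subset_right.trans ((hb.antitone n.le_succ).trans hn)))⟩
  choose V hVo hVx hVc hVb using hx
  refine ⟨V, ⟨fun y _ n => hVx y n, fun y _ n => ?_, fun y _ z _ n h => ?_, fun y _ z _ h => ?_,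
    fun y _ z _ n h => ?_⟩, hVb⟩
  · exact inter_subset_left.trans (subset_closure.trans (hVc y n))
  · obtain ⟨m, -, hm⟩ := (hVb z).mem_iff.1 ((hVo y n).mem_nhds h)
    exact ⟨m, inter_subset_left.trans hm⟩
  · obtain ⟨n, -, hn⟩ := (hVb y).mem_iff.1 (isOpen_compl_singleton.mem_nhds h.symm)
    exact ⟨n, fun hz => hn hz rfl⟩
  · have : (closure (V y (n + 1)))ᶜ ∈ 𝓝 z :=
      isClosed_closure.isOpen_compl.mem_nhds fun hz => h (hVc y n hz)
    obtain ⟨m, -, hm⟩ := (hVb z).mem_iff.1 this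
    exact ⟨m, Set.disjoint_left.2 fun w hw hw' => hm hw.1 (subset_closure hw')⟩

theorem IsRegularBaseOn.exists_topologicalSpace {Y : Type u} {B : Y → ℕ → Set Y}
    (hB : IsRegularBaseOn univ B) :
    ∃ t : TopologicalSpace Y, ∀ y, (@nhds Y t y).HasBasis (fun _ => True) (B y) := by
  have hanti : ∀ y, Antitone (B y) := fun y => antitone_nat_of_succ_le fun n z hz =>
    hB.anti y trivial n ⟨hz, trivial⟩
  have hb : ∀ y, (⨅ n, 𝓟 (B y n)).HasBasis (fun _ => True) (B y) := fun y =>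
    hasBasis_iInf_principal (hanti y).directed_ge
  refine ⟨TopologicalSpace.mkOfNhds fun y => ⨅ n, 𝓟 (B y n),
    fun y => ?_⟩
  rw [TopologicalSpace.nhds_mkOfNhds_of_hasBasis hb (fun y n _ => hB.mem y trivial n)
    fun y n _ => ?_]
  · exact hb y
  refine (hb y).mem_iff.2 ⟨n, trivial, fun z hz => ?_⟩
  obtain ⟨m, hm⟩ := hB.isOpen y trivial z trivial n hz
  exact (hb z).mem_iff.2 ⟨m, trivial, fun w hw => hm ⟨hw, trivial⟩⟩

theorem IsRegularBaseOn.t2Space {Y : Type u} [TopologicalSpace Y] {B : Y → ℕ → Set Y}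
    (hB : IsRegularBaseOn univ B) (hb : ∀ y, (𝓝 y).HasBasis (fun _ => True) (B y)) :
    T2Space Y := by
  refine t2Space_iff_disjoint_nhds.2 fun y z hyz => ?_
  obtain ⟨n, hn⟩ := hB.t1 y trivial z trivial hyz.symm
  obtain ⟨m, hm⟩ := hB.regular y trivial z trivial n hn
  rw [inter_univ] at hm
  exact Filter.disjoint_iff.2 ⟨_, (hb y).mem_of_mem trivial, _, (hb z).mem_of_mem trivial, hm.symm⟩

/-- Under Martin's Axiom, every regular first countable space with fewer than `𝔠` points is
densely embedded in a countably compact first countable Hausdorff space. -/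
theorem MartinsAxiom.exists_countablyCompact_extension (hMA : MartinsAxiom) (X : Type u)
    [TopologicalSpace X] [T3Space X] [FirstCountableTopology X]
    (hX : Cardinal.mk X < Cardinal.continuum) :
    ∃ (Y : Type u) (_ : TopologicalSpace Y) (i : X → Y), T2Space Y ∧ FirstCountableTopology Y ∧
      CountablyCompactSpace Y ∧ IsEmbedding i ∧ DenseRange i := by
  obtain ⟨V, hV, hVb⟩ := exists_isRegularBaseOn_nhds X
  obtain ⟨s, hs⟩ := exists_bookkeeping hX
  obtain ⟨F, hF⟩ := hMA.exists_admissible_family (mk_extensionStage_Iio_lt hX) V s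
  have hB := isRegularBaseOn_univ_extensionBall hF hV
  obtain ⟨t, ht⟩ := hB.exists_topologicalSpace
  have hT2 : T2Space (X ⊕ Cardinal.continuum.{u}.ord.ToType) := hB.t2Space ht
  have hfc : FirstCountableTopology (X ⊕ Cardinal.continuum.{u}.ord.ToType) := ⟨fun y => (ht y).isCountablyGenerated⟩
  -- Every sequence was listed and so has a cluster point; first countability turns it into the
  -- limit of a subsequence.
  have hseq : SeqCompactSpace (X ⊕ Cardinal.continuum.{u}.ord.ToType) := ⟨fun u _ => by
    obtain ⟨i, rfl, hi⟩ := hs u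
    obtain ⟨y, hy⟩ := exists_cluster_extensionBall hF hV hi
    have hc : MapClusterPt y atTop (s i) :=
      (ht y).mapClusterPt_iff_frequently.2 fun n _ => hy n
    obtain ⟨φ, hφ, hφy⟩ := hc.tendsto_subseq
    exact ⟨y, trivial, φ, hφ, hφy⟩⟩
  have hemb : IsEmbedding (Sum.inl : X → X ⊕ Cardinal.continuum.{u}.ord.ToType) := by
    refine ⟨isInducing_iff_nhds.2 fun x => ?_, Sum.inl_injective⟩
    have hV' : V x = fun n => Sum.inl ⁻¹' extensionBall V F (Sum.inl x) n := by
      ext n x'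
      exact inl_mem_extensionBall_inl.symm
    refine (hVb x).eq_of_same_basis ?_
    rw [hV']
    exact (ht (Sum.inl x)).comap Sum.inl
  -- The isolated dummy points may destroy density of `X`; the closure of `X` restores it and
  -- inherits countable compactness.
  refine ⟨closure (range (Sum.inl : X → X ⊕ Cardinal.continuum.{u}.ord.ToType)), inferInstance,
    fun x => ⟨Sum.inl x, subset_closure (mem_range_self x)⟩, inferInstance, inferInstance,
    isCountablyCompact_iff_countablyCompactSpace.1 isClosed_closure.isCountablyCompact,
    hemb.codRestrict _ _, ?_⟩
  rw [DenseRange, Subtype.dense_iff]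
  intro y hy
  rw [← range_comp]
  exact hy

theorem isClosed_range_of_countablyCompactSpace {Y Z : Type*} [TopologicalSpace Y]
    [TopologicalSpace Z] [CountablyCompactSpace Y] [FirstCountableTopology Y] [T2Space Z]
    [FirstCountableTopology Z] {j : Y → Z} (hj : Continuous j) : IsClosed (range j) := by
  have : IsSeqCompact (range j) := by
    rw [← image_univ]
    exact (SeqCompactSpace.isSeqCompact_univ (X := Y)).image hj.seqContinuous
  exact IsSeqClosed.isClosed fun u z hu hz => by
    obtain ⟨a, ha, φ, hφ, hφa⟩ := this hu
    exact tendsto_nhds_unique hφa (hz.comp hφ.tendsto_atTop) ▸ ha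

/-! ### M-spaces and the closed embedding -/

/-- A sequence of symmetric reflexive relations with `E (n + 1) ○ E (n + 1) ⊆ E n` is the
sequence of basic entourages of a map onto a metric space. -/
theorem exists_metricSpace_of_entourages {X : Type u} {E : ℕ → Set (X × X)}
    (hrefl : ∀ n x, (x, x) ∈ E n) (hsymm : ∀ n x y, (x, y) ∈ E n → (y, x) ∈ E n)
    (hcomp : ∀ n x y z, (x, y) ∈ E (n + 1) → (y, z) ∈ E (n + 1) → (x, z) ∈ E n) :
    ∃ (M : Type u) (_ : MetricSpace M) (f : X → M), Function.Surjective f ∧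
      ∀ x, (comap f (𝓝 (f x))).HasBasis (fun _ => True) fun n => {y | (x, y) ∈ E n} := by
  have hanti : Antitone E := antitone_nat_of_succ_le fun n => by
    rintro ⟨x, y⟩ hxy
    exact hcomp n x y y hxy (hrefl _ _)
  have hb : (⨅ n, 𝓟 (E n)).HasBasis (fun _ => True) E :=
    hasBasis_iInf_principal hanti.directed_ge
  let core : UniformSpace.Core X := UniformSpace.Core.mk' (⨅ n, 𝓟 (E n))
    (fun r hr x => by
      obtain ⟨n, -, hn⟩ := hb.mem_iff.1 hr
      exact hn (hrefl n x))
    (fun r hr => by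
      obtain ⟨n, -, hn⟩ := hb.mem_iff.1 hr
      exact hb.mem_iff.2 ⟨n, trivial, fun p hp => hn (hsymm n _ _ hp)⟩)
    (fun r hr => by
      obtain ⟨n, -, hn⟩ := hb.mem_iff.1 hr
      refine ⟨E (n + 1), hb.mem_of_mem trivial, ?_⟩
      rintro ⟨x, z⟩ ⟨y, hxy, hyz⟩
      exact hn (hcomp n x y z hxy hyz))
  let us : UniformSpace X := UniformSpace.ofCore core
  have hu : (uniformity X).HasBasis (fun _ => True) E := hb
  have : IsCountablyGenerated (uniformity X) := hu.isCountablyGenerated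
  let pm : PseudoMetricSpace X := UniformSpace.pseudoMetricSpace X
  refine ⟨SeparationQuotient X, inferInstance, SeparationQuotient.mk,
    SeparationQuotient.surjective_mk, fun x => ?_⟩
  rw [SeparationQuotient.comap_mk_nhds_mk]
  exact nhds_basis_uniformity' hu

/-- An M-space maps continuously onto a metric space in such a way that sequences whose images
converge have cluster points. -/
theorem IsMSpace.exists_map_metricSpace {X : Type u} [TopologicalSpace X] (h : IsMSpace X) :
    ∃ (M : Type u) (_ : MetricSpace M) (f : X → M), Continuous f ∧ Function.Surjective f ∧
      ∀ (x : X) (s : ℕ → X), Tendsto (f ∘ s) atTop (𝓝 (f x)) →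
        ∃ p, MapClusterPt p atTop s := by
  obtain ⟨𝒰, hcov, hstar, hcl⟩ := h
  -- Two members of `𝒰 (n + 1)` sharing a point lie in one member of `𝒰 n`, so star-refinement gives
  -- the composition law.
  let E : ℕ → Set (X × X) := fun n => {p | ∃ U ∈ 𝒰 n, p.1 ∈ U ∧ p.2 ∈ U}
  obtain ⟨M, hM, f, hf, hfb⟩ := exists_metricSpace_of_entourages (E := E)
    (fun n x => by
      obtain ⟨U, hU, hx⟩ := mem_sUnion.1 ((hcov n).2.symm ▸ mem_univ x : x ∈ ⋃₀ 𝒰 n)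
      exact ⟨U, hU, hx, hx⟩)
    (fun n x y ⟨U, hU, hx, hy⟩ => ⟨U, hU, hy, hx⟩)
    (fun n x y z ⟨V, hV, hxV, hyV⟩ ⟨W, hW, hyW, hzW⟩ => by
      obtain ⟨U, hU, hVU⟩ := hstar n V hV
      exact ⟨U, hU, hVU ⟨V, ⟨hV, ⟨x, hxV, hxV⟩⟩, hxV⟩, hVU ⟨W, ⟨hW, ⟨y, hyW, hyV⟩⟩, hzW⟩⟩)
  refine ⟨M, hM, f, continuous_iff_continuousAt.2 fun x => ?_, hf, fun x s hs => ?_⟩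
  · refine tendsto_iff_comap.2 ((hfb x).ge_iff.2 fun n _ => ?_)
    obtain ⟨U, hU, hx⟩ := mem_sUnion.1 ((hcov n).2.symm ▸ mem_univ x : x ∈ ⋃₀ 𝒰 n)
    exact mem_of_superset (((hcov n).1 U hU).mem_nhds hx) fun y hy => ⟨U, hU, hx, hy⟩
  · have hs' : ∀ n, ∀ᶠ k in atTop, s k ∈ coverStar {x} (𝒰 n) := by
      intro n
      filter_upwards [(tendsto_comap_iff.2 hs).eventually ((hfb x).mem_of_mem (i := n) trivial)]
        with k hk
      obtain ⟨U, hU, hx, hk⟩ := hk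
      exact ⟨U, ⟨hU, ⟨x, hx, rfl⟩⟩, hk⟩
    -- The M-space condition wants the `n`-th term in the `n`-th star, hence the subsequence.
    obtain ⟨φ, hφ, hφs⟩ := extraction_forall_of_eventually hs'
    obtain ⟨p, hp⟩ := hcl x (s ∘ φ) hφs
    exact ⟨p, hp.of_comp hφ.tendsto_atTop⟩

/-- `C × M` is first countable, so sequential closedness suffices. If `(i (s n), f (s n))` converges
to `z`, surjectivity of `f` makes `z.2` a value of `f`, so `s` has a cluster point `p`; since `C`
and `M` are Hausdorff, `z = (i p, f p)`. -/
theorem IsMSpace.embedsClosed {X C : Type u} [TopologicalSpace X] [TopologicalSpace C] [T2Space C]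
    [FirstCountableTopology C] [CountablyCompactSpace C] (h : IsMSpace X) {i : X → C}
    (hi : IsEmbedding i) : EmbedsClosedInCountablyCompactProdMetric X := by
  obtain ⟨M, hM, f, hf, hsurj, hseq⟩ := h.exists_map_metricSpace
  have hemb : IsEmbedding fun x => (i x, f x) := by
    refine .of_comp (hi.continuous.prodMk hf) continuous_fst ?_
    exact hi
  refine ⟨C, inferInstance, M, hM, inferInstance, inferInstance, range fun x => (i x, f x),
    IsSeqClosed.isClosed fun u z hu hz => ?_, ⟨hemb.toHomeomorph⟩⟩
  choose s hs using hu
  obtain ⟨x, hx⟩ := hsurj z.2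
  have h1 : Tendsto (i ∘ s) atTop (𝓝 z.1) := by
    have := (continuous_fst.tendsto z).comp hz
    exact this.congr fun n => by simp [← hs]
  have h2 : Tendsto (f ∘ s) atTop (𝓝 z.2) := by
    have := (continuous_snd.tendsto z).comp hz
    exact this.congr fun n => by simp [← hs]
  obtain ⟨p, hp⟩ := hseq x s (hx ▸ h2)
  refine ⟨p, Prod.ext ?_ ?_⟩
  · exact eq_of_nhds_neBot ((hp.tendsto_comp hi.continuous.continuousAt).neBot.mono
      (inf_le_inf_left _ h1))
  · exact eq_of_nhds_neBot ((hp.tendsto_comp hf.continuousAt).neBot.mono (inf_le_inf_left _ h2))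

theorem corollary2p2 (hMA : MartinsAxiom) (X : Type u) [TopologicalSpace X] [T3Space X]
    [FirstCountableTopology X] (hX : Cardinal.mk X < Cardinal.continuum) :
    (IsMSpace X → EmbedsClosedInCountablyCompactProdMetric X) ∧
      ∃ (Y : Type u) (_ : TopologicalSpace Y) (i : X → Y), IsMaximalFirstCountableExtension i := by
  obtain ⟨Y, tY, i, hT2, hfc, hcc, hemb, hdense⟩ := hMA.exists_countablyCompact_extension X hX
  exact ⟨fun hM => hM.embedsClosed hemb, Y, tY, i, hT2, hfc, hemb, hdense,
    fun Z _ _ _ j hj => isClosed_range_of_countablyCompactSpace hj.continuous⟩
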